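/- Let $a>0$, $b,c\in\mathbb{R}$ with $c\neq 0$, and $\theta_1,\theta_2\in[0,2\pi)$. On $\mathcal{H}=L^2(0,1)$ with $\langle f,g\rangle=\int_0^1 f g$, define for $f\in H^2(0,1)$ $$\mathcal{A}_c f = a f''+(b+c) f,\qquad \mathcal{B}f=\big(\cos(\theta_1)f(0)-\sin(\theta_1)f'(0),\ \cos(\theta_2)f(1)+\sin(\theta_2)f'(1)\big)\in\mathbb{R}^2,$$ and let $\mathcal{A}_{c,0}$ be the restriction of $\mathcal{A}_c$ to $H^2(0,1)\cap\ker\mathcal{B}$. Let $\lambda_1>\lambda_2>\cdots$ be the eigenvalues of $\mathcal{A}_{c,0}$, listed in strictly decreasing order, and for each $n\geq 1$ let $e_n$ be a unit eigenvector of $\mathcal{A}_{c,0}$ associated with $\lambda_n$. Let $k\geq 2$ be an integer with $\cos(\theta_m)+k\sin(\theta_m)\neq 0$ for $m\in\{1,2\}$, and for $u=(u_1,u_2)\in\mathbb{R}^2$ set $$[L_k u](x)=\frac{u_1(1-x)^k}{\cos(\theta_1)+k\sin(\theta_1)}+\frac{u_2x^k}{\cos(\theta_2)+k\sin(\theta_2)},\qquad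 x\in[0,1].$$ With $\{f_1,f_2\}$ the canonical basis of $\mathbb{R}^2$, put $$b_{n,m}=-\lambda_n\langle L_kf_m,e_n\rangle+\langle \mathcal{A}_cL_kf_m,e_n\rangle ,\qquad n\geq 1,\ m\in\{1,2\}.$$ For an integer $N_0\geq 1$ let $A=\mathrm{diag}(\lambda_1,\ldots,\lambda_{N_0})\in\mathbb{R}^{N_0\times N_0}$, let $B=(b_{n,m})_{1\le n\le N_0,\,1\le m\le 2}\in\mathbb{R}^{N_0\times 2}$, and let $B_1,B_2\in\mathbb{R}^{N_0}$ be the columns of $B$. Then, for every $N_0\geq 1$, each of the pairs $(A,B)$, $(A,B_1)$ and $(A,B_2)$ satisfies the Kalman condition, that is, the matrices $[B, AB,\ldots,A^{N_0-1}B]$, $[B_1, AB_1,\ldots,A^{N_0-1}B_1]$ and $[B_2, AB_2,\ldots,A^{N_0-1}B_2]$ all have rank $N_0$. -/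

import Mathlib

open MeasureTheory Set

noncomputable section

namespace RobinHeat

/-- First derivative on `[0,1]` (one-sided at the two end points). -/
def D (f : ℝ → ℝ) : ℝ → ℝ := derivWithin f (Icc 0 1)

/-- Membership in `H²(0,1)`: `f` is `C¹` on `[0,1]`, its derivative is absolutely continuous on
`[0,1]`, and the (almost everywhere defined) second derivative is in `L²(0,1)`.
A class of `L²(0,1)` that lies in `H²(0,1)` is represented by its unique `C¹` representative. -/
def MemH2 (f : ℝ → ℝ) : Prop :=
  ContDiffOn ℝ 1 f (Icc 0 1) ∧
    AbsolutelyContinuousOnInterval (D f) 0 1 ∧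
    MemLp (D (D f)) 2 (volume.restrict (Ioo 0 1))

/-- The inner product of `L²(0,1)`. -/
def ip (f g : ℝ → ℝ) : ℝ := ∫ x in Ioo (0 : ℝ) 1, f x * g x

/-- The operator `𝒜 f = a f'' + b f`, with domain `H²(0,1)`. -/
def opA (a b : ℝ) (f : ℝ → ℝ) : ℝ → ℝ := fun x => a * D (D f) x + b * f x

/-- The operator `𝒜_c = 𝒜 + c I`, with domain `H²(0,1)`. -/
def opAc (a b c : ℝ) (f : ℝ → ℝ) : ℝ → ℝ := fun x => opA a b f x + c * f x

/-- The boundary operator `ℬ`, with domain `H²(0,1)`; `θ 0`, `θ 1` stand for `θ₁`, `θ₂`. -/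
def opB (θ : Fin 2 → ℝ) (f : ℝ → ℝ) : Fin 2 → ℝ :=
  ![Real.cos (θ 0) * f 0 - Real.sin (θ 0) * D f 0,
    Real.cos (θ 1) * f 1 + Real.sin (θ 1) * D f 1]

/-- Membership in the domain `H²(0,1) ∩ ker ℬ` of `𝒜_{c,0}`. -/
def MemDom0 (θ : Fin 2 → ℝ) (f : ℝ → ℝ) : Prop := MemH2 f ∧ opB θ f = 0

/-- `e` is a unit eigenvector of `𝒜_{c,0}` (the restriction of `𝒜_c` to `H²(0,1) ∩ ker ℬ`)
for the eigenvalue `μ`; the eigenvalue equation is an equation in `L²(0,1)`. -/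
def IsUnitEigenvector (a b c : ℝ) (θ : Fin 2 → ℝ) (μ : ℝ) (e : ℝ → ℝ) : Prop :=
  MemDom0 θ e ∧ ip e e = 1 ∧
    ∀ᵐ x ∂(volume.restrict (Ioo (0 : ℝ) 1)), opAc a b c e x = μ * e x

/-- The set of eigenvalues of `𝒜_{c,0}`. -/
def eigenvalues (a b c : ℝ) (θ : Fin 2 → ℝ) : Set ℝ :=
  {μ | ∃ e, IsUnitEigenvector a b c θ μ e}

/-- The lifting operator `L_k`. -/
def lift (θ : Fin 2 → ℝ) (k : ℕ) (u : Fin 2 → ℝ) : ℝ → ℝ := fun x =>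
  u 0 * (1 - x) ^ k / (Real.cos (θ 0) + k * Real.sin (θ 0)) +
    u 1 * x ^ k / (Real.cos (θ 1) + k * Real.sin (θ 1))

/-- `-μ ⟨L_k f_m, e⟩ + ⟨𝒜_c L_k f_m, e⟩`, where `f_m` is the `m`-th canonical basis vector. -/
def inputCoeff (a b c : ℝ) (θ : Fin 2 → ℝ) (k : ℕ) (μ : ℝ) (e : ℝ → ℝ) (m : Fin 2) : ℝ :=
  -μ * ip (lift θ k (Pi.single m 1)) e + ip (opAc a b c (lift θ k (Pi.single m 1))) e

/-- `A = diag(λ₁, …, λ_N)`; the sequence is indexed from `0`. -/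
def matA (N : ℕ) (lam : ℕ → ℝ) : Matrix (Fin N) (Fin N) ℝ :=
  Matrix.diagonal fun n => lam n

/-- `B = (b_{n,m})`, of size `N × 2`. -/
def matB (a b c : ℝ) (θ : Fin 2 → ℝ) (k N : ℕ) (lam : ℕ → ℝ) (e : ℕ → ℝ → ℝ) :
    Matrix (Fin N) (Fin 2) ℝ :=
  Matrix.of fun n m => inputCoeff a b c θ k (lam n) (e n) m

/-- The `m`-th column of `B`, as a matrix with one column. -/
def column {N : ℕ} (B : Matrix (Fin N) (Fin 2) ℝ) (m : Fin 2) : Matrix (Fin N) (Fin 1) ℝ :=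
  Matrix.of fun n _ => B n m

/-- The controllability matrix `[B, AB, …, A^{N-1}B]`; column `(j, m)` is the `m`-th column of
`A^j B`. -/
def kalmanMatrix {N p : ℕ} (A : Matrix (Fin N) (Fin N) ℝ) (B : Matrix (Fin N) (Fin p) ℝ) :
    Matrix (Fin N) (Fin N × Fin p) ℝ :=
  Matrix.of fun i jm => (A ^ (jm.1 : ℕ) * B) i jm.2

/-- The Kalman rank condition for the pair `(A, B)`. -/
def Kalman {N p : ℕ} (A : Matrix (Fin N) (Fin N) ℝ) (B : Matrix (Fin N) (Fin p) ℝ) : Prop :=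
  (kalmanMatrix A B).rank = N

end RobinHeat

end

namespace RobinHeat

/-- A diagonal matrix with distinct entries and an input matrix having a column without zero entry
satisfy the Kalman condition. -/
theorem kalman_diagonal {N p : ℕ} {d : Fin N → ℝ} (hd : Function.Injective d)
    (B : Matrix (Fin N) (Fin p) ℝ) (m : Fin p) (hB : ∀ n, B n m ≠ 0) :
    Kalman (Matrix.diagonal d) B := by
  have hsub : (kalmanMatrix (Matrix.diagonal d) B).submatrix id (fun j => (j, m)) =
      Matrix.diagonal (fun n => B n m) * Matrix.vandermonde d := by
    ext i j
    simp [kalmanMatrix, Matrix.diagonal_pow, Matrix.diagonal_mul, Matrix.vandermonde_apply,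
      mul_comm]
  have hdet : (Matrix.diagonal (fun n => B n m) * Matrix.vandermonde d).det ≠ 0 := by
    rw [Matrix.det_mul, Matrix.det_diagonal]
    exact mul_ne_zero (Finset.prod_ne_zero_iff.2 fun n _ => hB n)
      (Matrix.det_vandermonde_ne_zero_iff.2 hd)
  have hrank := Matrix.rank_of_isUnit _
    ((Matrix.isUnit_iff_isUnit_det _).2 (isUnit_iff_ne_zero.2 hdet))
  have hle := Matrix.rank_submatrix_le (kalmanMatrix (Matrix.diagonal d) B) id
    (fun j : Fin N => (j, m))
  rw [hsub, hrank, Fintype.card_fin] at hle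
  refine le_antisymm ?_ hle
  simpa using Matrix.rank_le_card_height (kalmanMatrix (Matrix.diagonal d) B)

theorem ip_eq_intervalIntegral (f g : ℝ → ℝ) : ip f g = ∫ x in (0 : ℝ)..1, f x * g x := by
  rw [intervalIntegral.integral_of_le zero_le_one, integral_Ioc_eq_integral_Ioo, ip]

theorem D_eq_of_hasDerivAt {f f' : ℝ → ℝ} (hf : ∀ x, HasDerivAt f (f' x) x) {x : ℝ}
    (hx : x ∈ Icc (0 : ℝ) 1) : D f x = f' x :=
  (hf x).hasDerivWithinAt.derivWithin (uniqueDiffOn_Icc zero_lt_one x hx)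

theorem D_D_eq_of_hasDerivAt {f f' f'' : ℝ → ℝ} (hf : ∀ x, HasDerivAt f (f' x) x)
    (hf' : ∀ x, HasDerivAt f' (f'' x) x) {x : ℝ} (hx : x ∈ Icc (0 : ℝ) 1) :
    D (D f) x = f'' x := by
  rw [← D_eq_of_hasDerivAt hf' hx]
  exact derivWithin_congr (fun y hy => D_eq_of_hasDerivAt hf hy) (D_eq_of_hasDerivAt hf hx)

theorem MemH2.hasDerivWithinAt {f : ℝ → ℝ} (hf : MemH2 f) {x : ℝ} (hx : x ∈ Icc (0 : ℝ) 1) :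
    HasDerivWithinAt f (D f x) (Icc 0 1) x :=
  (hf.1.differentiableOn one_ne_zero x hx).hasDerivWithinAt

theorem MemH2.continuousOn {f : ℝ → ℝ} (hf : MemH2 f) : ContinuousOn f (Icc 0 1) :=
  hf.1.continuousOn

theorem MemH2.continuousOn_D {f : ℝ → ℝ} (hf : MemH2 f) : ContinuousOn (D f) (Icc 0 1) := by
  simpa using hf.2.1.continuousOn

/-- If the weak second derivative of an `H²` function is almost everywhere equal to a continuous
function, then it is a classical second derivative. -/
theorem MemH2.hasDerivWithinAt_D {f g : ℝ → ℝ} (hf : MemH2 f) (hg : ContinuousOn g (Icc 0 1))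
    (h : ∀ᵐ x ∂(volume.restrict (Ioo (0 : ℝ) 1)), D (D f) x = g x) {x : ℝ}
    (hx : x ∈ Icc (0 : ℝ) 1) : HasDerivWithinAt (D f) (g x) (Icc 0 1) x := by
  set G : ℝ → ℝ := IccExtend zero_le_one ((Icc (0 : ℝ) 1).domRestrict g) with hG
  have hGc : Continuous G := (continuousOn_iff_continuous_domRestrict.1 hg).Icc_extend'
  have hGg : ∀ y ∈ Icc (0 : ℝ) 1, G y = g y := fun y hy => by
    rw [hG, IccExtend_of_mem _ _ hy]; rfl
  have hD : ∀ y ∈ Icc (0 : ℝ) 1, D f y = D f 0 + ∫ t in (0 : ℝ)..y, G t := by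
    intro y hy
    have hac : AbsolutelyContinuousOnInterval (D f) 0 y := hf.2.1.mono (by
      rw [uIcc_of_le hy.1, uIcc_of_le zero_le_one]; exact Icc_subset_Icc_right hy.2)
    have hint : ∫ t in (0 : ℝ)..y, deriv (D f) t = ∫ t in (0 : ℝ)..y, G t := by
      rw [intervalIntegral.integral_of_le hy.1, intervalIntegral.integral_of_le hy.1,
        integral_Ioc_eq_integral_Ioo, integral_Ioc_eq_integral_Ioo]
      refine integral_congr_ae ?_
      have hsub : Ioo 0 y ⊆ Ioo (0 : ℝ) 1 := Ioo_subset_Ioo_right hy.2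
      filter_upwards [ae_restrict_of_ae_restrict_of_subset hsub h,
        ae_restrict_mem measurableSet_Ioo] with t ht htm
      rw [hGg t (Ioo_subset_Icc_self (hsub htm)), ← ht]
      exact (derivWithin_of_mem_nhds (Icc_mem_nhds (hsub htm).1 (hsub htm).2)).symm
    linarith [hac.integral_deriv_eq_sub]
  rw [← hGg x hx]
  exact ((hGc.integral_hasStrictDerivAt 0 x).hasDerivAt.const_add
    (D f 0)).hasDerivWithinAt.congr hD (hD x hx)

theorem IsUnitEigenvector.hasDerivWithinAt_D {a b c μ : ℝ} {θ : Fin 2 → ℝ} {e : ℝ → ℝ}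
    (ha : a ≠ 0) (he : IsUnitEigenvector a b c θ μ e) {x : ℝ} (hx : x ∈ Icc (0 : ℝ) 1) :
    HasDerivWithinAt (D e) ((μ - b - c) / a * e x) (Icc 0 1) x := by
  refine he.1.1.hasDerivWithinAt_D (g := fun y => (μ - b - c) / a * e y)
    (he.1.1.continuousOn.const_mul _) ?_ hx
  filter_upwards [he.2.2] with y hy
  simp only [opAc, opA] at hy
  field_simp
  linarith

/-- The Green formula for an eigenvector and a `C²` function. -/
theorem IsUnitEigenvector.green {a b c μ : ℝ} {θ : Fin 2 → ℝ} {e : ℝ → ℝ}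
    (ha : a ≠ 0) (he : IsUnitEigenvector a b c θ μ e) {f f' f'' : ℝ → ℝ}
    (hf : ∀ x, HasDerivAt f (f' x) x) (hf' : ∀ x, HasDerivAt f' (f'' x) x)
    (hf'' : Continuous f'') :
    -μ * ip f e + ip (opAc a b c f) e =
      a * ((f' 1 * e 1 - f 1 * D e 1) - (f' 0 * e 0 - f 0 * D e 0)) := by
  have hfc : Continuous f := continuous_iff_continuousAt.2 fun x => (hf x).continuousAt
  have hfc' : Continuous f' := continuous_iff_continuousAt.2 fun x => (hf' x).continuousAt
  have hec := he.1.1.continuousOn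
  have hint : ∀ {w : ℝ → ℝ}, ContinuousOn w (Icc 0 1) →
      IntervalIntegrable w volume 0 1 := fun hw =>
    ContinuousOn.intervalIntegrable (by rwa [uIcc_of_le zero_le_one])
  have hcont : ContinuousOn (fun x => f' x * e x - f x * D e x) (Icc 0 1) :=
    (hfc'.continuousOn.mul hec).sub (hfc.continuousOn.mul he.1.1.continuousOn_D)
  have hderiv : ∀ x ∈ Ioo (0 : ℝ) 1, HasDerivAt (fun x => f' x * e x - f x * D e x)
      (f'' x * e x - f x * ((μ - b - c) / a * e x)) x := by
    intro x hx
    have hn := Icc_mem_nhds hx.1 hx.2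
    have h1 := (he.1.1.hasDerivWithinAt (Ioo_subset_Icc_self hx)).hasDerivAt hn
    have h2 := (he.hasDerivWithinAt_D ha (Ioo_subset_Icc_self hx)).hasDerivAt hn
    exact (((hf' x).mul h1).sub ((hf x).mul h2)).congr_deriv (by ring)
  have hftc := intervalIntegral.integral_eq_sub_of_hasDerivAt_of_le zero_le_one hcont hderiv
    (hint ((hf''.continuousOn.mul hec).sub
      (hfc.continuousOn.mul (hec.const_mul ((μ - b - c) / a)))))
  have hop : ip (opAc a b c f) e =
      ∫ x in (0 : ℝ)..1, (a * f'' x + b * f x + c * f x) * e x := by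
    rw [ip_eq_intervalIntegral]
    refine intervalIntegral.integral_congr fun x hx => ?_
    rw [uIcc_of_le zero_le_one] at hx
    simp only [opAc, opA, D_D_eq_of_hasDerivAt hf hf' hx]
  rw [← hftc, hop, ip_eq_intervalIntegral, ← intervalIntegral.integral_const_mul,
    ← intervalIntegral.integral_const_mul, ← intervalIntegral.integral_add]
  · refine intervalIntegral.integral_congr fun x _ => ?_
    field_simp
    ring
  · exact hint ((hfc.continuousOn.mul hec).const_mul (-μ))
  · exact hint (Continuous.continuousOn (by fun_prop) |>.mul hec)

theorem not_isUnitEigenvector_of_eqOn_zero {a b c μ : ℝ} {θ : Fin 2 → ℝ} {e : ℝ → ℝ}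
    (h : ∀ x ∈ Icc (0 : ℝ) 1, e x = 0) : ¬ IsUnitEigenvector a b c θ μ e := by
  intro he
  have h0 : ip e e = 0 :=
    setIntegral_eq_zero_of_forall_eq_zero fun x hx => by simp [h x (Ioo_subset_Icc_self hx)]
  exact one_ne_zero (he.2.1.symm.trans h0)

/-- The vector field of the first-order system for a function whose second derivative is `q` times itself. -/
def secondOrderField (q : ℝ) : ℝ × ℝ →L[ℝ] ℝ × ℝ :=
  (ContinuousLinearMap.snd ℝ ℝ ℝ).prod (q • ContinuousLinearMap.fst ℝ ℝ ℝ)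

theorem IsUnitEigenvector.hasDerivWithinAt_prodMk {a b c μ : ℝ} {θ : Fin 2 → ℝ} {e : ℝ → ℝ}
    (ha : a ≠ 0) (he : IsUnitEigenvector a b c θ μ e) {x : ℝ} (hx : x ∈ Icc (0 : ℝ) 1) :
    HasDerivWithinAt (fun y => (e y, D e y))
      (secondOrderField ((μ - b - c) / a) (e x, D e x)) (Icc 0 1) x :=
  (he.1.1.hasDerivWithinAt hx).prodMk (he.hasDerivWithinAt_D ha hx)

theorem IsUnitEigenvector.cauchyData_zero_ne {a b c μ : ℝ} {θ : Fin 2 → ℝ} {e : ℝ → ℝ}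
    (ha : a ≠ 0) (he : IsUnitEigenvector a b c θ μ e) : ¬ (e 0 = 0 ∧ D e 0 = 0) := by
  rintro ⟨h0, h1⟩
  have hu := ODE_solution_unique_of_mem_Icc_right (a := 0) (b := 1)
    (v := fun _ => secondOrderField ((μ - b - c) / a)) (s := fun _ => univ)
    (f := fun y => (e y, D e y)) (g := fun _ => 0)
    (fun _ _ => (secondOrderField ((μ - b - c) / a)).lipschitz.lipschitzOnWith)
    (he.1.1.continuousOn.prodMk he.1.1.continuousOn_D)
    (fun t ht => (he.hasDerivWithinAt_prodMk ha (Ico_subset_Icc_self ht)).mono_of_mem_nhdsWithin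
      (Icc_mem_nhdsGE_of_mem ht))
    (fun _ _ => mem_univ _) continuousOn_const
    (fun t _ => by simpa using hasDerivWithinAt_const t (Ici t) (0 : ℝ × ℝ))
    (fun _ _ => mem_univ _) (by simp [h0, h1])
  exact not_isUnitEigenvector_of_eqOn_zero (fun x hx => congrArg Prod.fst (hu hx)) he

theorem IsUnitEigenvector.cauchyData_one_ne {a b c μ : ℝ} {θ : Fin 2 → ℝ} {e : ℝ → ℝ}
    (ha : a ≠ 0) (he : IsUnitEigenvector a b c θ μ e) : ¬ (e 1 = 0 ∧ D e 1 = 0) := by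
  rintro ⟨h0, h1⟩
  have hu := ODE_solution_unique_of_mem_Icc_left (a := 0) (b := 1)
    (v := fun _ => secondOrderField ((μ - b - c) / a)) (s := fun _ => univ)
    (f := fun y => (e y, D e y)) (g := fun _ => 0)
    (fun _ _ => (secondOrderField ((μ - b - c) / a)).lipschitz.lipschitzOnWith)
    (he.1.1.continuousOn.prodMk he.1.1.continuousOn_D)
    (fun t ht => (he.hasDerivWithinAt_prodMk ha (Ioc_subset_Icc_self ht)).mono_of_mem_nhdsWithin
      (Icc_mem_nhdsLE_of_mem ht))
    (fun _ _ => mem_univ _) continuousOn_const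
    (fun t _ => by simpa using hasDerivWithinAt_const t (Iic t) (0 : ℝ × ℝ))
    (fun _ _ => mem_univ _) (by simp [h0, h1])
  exact not_isUnitEigenvector_of_eqOn_zero (fun x hx => congrArg Prod.fst (hu hx)) he

/-- A nonzero vector orthogonal to `(cos t, -sin t)` is not orthogonal to `(k, 1)` when
`cos t + k sin t ≠ 0`. -/
theorem robin_functional_ne_zero {t k y z : ℝ} (hk : Real.cos t + k * Real.sin t ≠ 0)
    (h : Real.cos t * y - Real.sin t * z = 0) (hyz : ¬ (y = 0 ∧ z = 0)) : z + k * y ≠ 0 := by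
  intro h0
  have hz : z = -(k * y) := by linarith
  subst hz
  have hy : (Real.cos t + k * Real.sin t) * y = 0 := by linarith
  have hy0 := (mul_eq_zero.1 hy).resolve_left hk
  exact hyz ⟨hy0, by simp [hy0]⟩

theorem IsUnitEigenvector.inputCoeff_zero_ne_zero {a b c μ : ℝ} {θ : Fin 2 → ℝ} {e : ℝ → ℝ}
    {k : ℕ} (ha : a ≠ 0) (hk : 2 ≤ k) (hkθ : Real.cos (θ 0) + k * Real.sin (θ 0) ≠ 0)
    (he : IsUnitEigenvector a b c θ μ e) : inputCoeff a b c θ k μ e 0 ≠ 0 := by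
  obtain ⟨j, rfl⟩ := Nat.exists_eq_add_of_le hk
  set d := Real.cos (θ 0) + ((2 + j : ℕ) : ℝ) * Real.sin (θ 0) with hd
  have hl : lift θ (2 + j) (Pi.single 0 1) = fun x => (1 - x) ^ (j + 2) / d := by
    funext x; simp [lift, hd, add_comm 2 j]
  have hs : ∀ x : ℝ, HasDerivAt (fun x : ℝ => 1 - x) (-1) x := fun x =>
    (hasDerivAt_id x).const_sub 1
  have h1 : ∀ x : ℝ, HasDerivAt (fun x : ℝ => (1 - x) ^ (j + 2) / d)
      (-((j + 2 : ℕ) : ℝ) * (1 - x) ^ (j + 1) / d) x := fun x =>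
    (((hs x).fun_pow (j + 2)).div_const d).congr_deriv (by simp; ring)
  have h2 : ∀ x : ℝ, HasDerivAt (fun x : ℝ => -((j + 2 : ℕ) : ℝ) * (1 - x) ^ (j + 1) / d)
      (((j + 2 : ℕ) : ℝ) * (((j + 1 : ℕ) : ℝ) * (1 - x) ^ j) / d) x := fun x =>
    ((((hs x).fun_pow (j + 1)).const_mul _).div_const d).congr_deriv (by simp; ring)
  have hb : Real.cos (θ 0) * e 0 - Real.sin (θ 0) * D e 0 = 0 := by
    simpa [opB] using congrFun he.1.2 0
  have hne := robin_functional_ne_zero hkθ hb (he.cauchyData_zero_ne ha)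
  have hval : inputCoeff a b c θ (2 + j) μ e 0 =
      a * ((D e 0 + ((2 + j : ℕ) : ℝ) * e 0) / d) := by
    rw [inputCoeff, hl, he.green ha h1 h2 (by fun_prop)]
    simp only [sub_self, sub_zero, zero_pow, one_pow, ne_eq, Nat.add_eq_zero_iff, OfNat.ofNat_ne_zero,
      one_ne_zero, and_false, not_false_eq_true]
    push_cast
    ring
  rw [hval]
  exact mul_ne_zero ha (div_ne_zero hne hkθ)

theorem IsUnitEigenvector.inputCoeff_one_ne_zero {a b c μ : ℝ} {θ : Fin 2 → ℝ} {e : ℝ → ℝ}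
    {k : ℕ} (ha : a ≠ 0) (hk : 2 ≤ k) (hkθ : Real.cos (θ 1) + k * Real.sin (θ 1) ≠ 0)
    (he : IsUnitEigenvector a b c θ μ e) : inputCoeff a b c θ k μ e 1 ≠ 0 := by
  obtain ⟨j, rfl⟩ := Nat.exists_eq_add_of_le hk
  set d := Real.cos (θ 1) + ((2 + j : ℕ) : ℝ) * Real.sin (θ 1) with hd
  have hl : lift θ (2 + j) (Pi.single 1 1) = fun x => x ^ (j + 2) / d := by
    funext x; simp [lift, hd, add_comm 2 j]
  have h1 : ∀ x : ℝ, HasDerivAt (fun x : ℝ => x ^ (j + 2) / d)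
      (((j + 2 : ℕ) : ℝ) * x ^ (j + 1) / d) x := fun x =>
    (hasDerivAt_pow (j + 2) x).div_const d
  have h2 : ∀ x : ℝ, HasDerivAt (fun x : ℝ => ((j + 2 : ℕ) : ℝ) * x ^ (j + 1) / d)
      (((j + 2 : ℕ) : ℝ) * (((j + 1 : ℕ) : ℝ) * x ^ j) / d) x := fun x =>
    ((hasDerivAt_pow (j + 1) x).const_mul _).div_const d
  have hb : Real.cos (θ 1) * e 1 - Real.sin (θ 1) * -D e 1 = 0 := by
    simpa [opB] using congrFun he.1.2 1
  have hne := robin_functional_ne_zero hkθ hb fun h =>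
    he.cauchyData_one_ne ha ⟨h.1, neg_eq_zero.1 h.2⟩
  have hval : inputCoeff a b c θ (2 + j) μ e 1 =
      a * ((-D e 1 + ((2 + j : ℕ) : ℝ) * e 1) / d) := by
    rw [inputCoeff, hl, he.green ha h1 h2 (by fun_prop)]
    simp only [zero_pow, one_pow, ne_eq, Nat.add_eq_zero_iff, OfNat.ofNat_ne_zero,
      one_ne_zero, and_false, not_false_eq_true]
    push_cast
    ring
  rw [hval]
  exact mul_ne_zero ha (div_ne_zero hne hkθ)

end RobinHeat

theorem lemma1 (a b c : ℝ) (ha : 0 < a) (hc : c ≠ 0)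
    (θ : Fin 2 → ℝ) (hθ : ∀ m, θ m ∈ Set.Ico 0 (2 * Real.pi))
    (k : ℕ) (hk : 2 ≤ k) (hkθ : ∀ m, Real.cos (θ m) + k * Real.sin (θ m) ≠ 0)
    (lam : ℕ → ℝ) (hlam : StrictAnti lam)
    (hspec : Set.range lam = RobinHeat.eigenvalues a b c θ)
    (e : ℕ → ℝ → ℝ) (he : ∀ n, RobinHeat.IsUnitEigenvector a b c θ (lam n) (e n))
    (N₀ : ℕ) (hN₀ : 1 ≤ N₀) :
    RobinHeat.Kalman (RobinHeat.matA N₀ lam) (RobinHeat.matB a b c θ k N₀ lam e) ∧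
    RobinHeat.Kalman (RobinHeat.matA N₀ lam)
      (RobinHeat.column (RobinHeat.matB a b c θ k N₀ lam e) 0) ∧
    RobinHeat.Kalman (RobinHeat.matA N₀ lam)
      (RobinHeat.column (RobinHeat.matB a b c θ k N₀ lam e) 1) := by
  have hinj : Function.Injective fun n : Fin N₀ => lam n :=
    hlam.injective.comp Fin.val_injective
  have h0 : ∀ n : Fin N₀, RobinHeat.matB a b c θ k N₀ lam e n 0 ≠ 0 := fun n =>
    (he n).inputCoeff_zero_ne_zero ha.ne' hk (hkθ 0)
  have h1 : ∀ n : Fin N₀, RobinHeat.matB a b c θ k N₀ lam e n 1 ≠ 0 := fun n =>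
    (he n).inputCoeff_one_ne_zero ha.ne' hk (hkθ 1)
  exact ⟨RobinHeat.kalman_diagonal hinj _ 0 h0, RobinHeat.kalman_diagonal hinj _ 0 h0,
    RobinHeat.kalman_diagonal hinj _ 0 h1⟩
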